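/- All vector spaces are real. A Fréchet space is a locally convex Hausdorff topological vector space whose topology is induced by a complete translation-invariant metric. A continuous linear map $T\colon X\to Y$ is called closed under finite-codimensional subspaces if $T(X_0)$ is closed in $Y$ for every closed linear subspace $X_0\subset X$ with $\dim(X/X_0)<\infty$. A subset $D$ of a locally convex Hausdorff topological vector space $X$ is called generalized polyhedral convex if there are a closed affine subspace $L\subset X$, an integer $m\ge 0$, continuous linear functionals $x_1^*,\dots,x_m^*\in X^*$ and real numbers $\alpha_1,\dots,\alpha_m$ with $D=\{x\in L \mid \langle x_i^*,x\rangle\le\alpha_i,\ i=1,\dots,m\}$. (1) Let $X$ and $Y$ be Fréchet spaces and $T\colon X\to Y$ a continuous linear map. Then $T$ is closed under finite-codimensional subspaces if and only if $T(X)$ is closed in $Y$. (2) Let $X$ be a locally convex Hausdorff topological vector space, let $Y$ and $Z$ be Fréchet spaces, and let $F\colon X\rightrightarrows Y$ be a multifunction (each $F(x)$ is a possibly empty subset of $Y$) whose graph has the form $$\{(x,y)\mid y\in F(x)\}=\{(x,y)\in X\times Y \mid A_1(x)+A_2(y)=z,\ \langle x_i^*,x\rangle+\langle y_i^*,y\rangle\le\beta_i,\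 i=1,\dots,m\},$$ where $A_1\colon X\to Z$ and $A_2\colon Y\to Z$ are continuous linear maps, $z\in Z$, $m\ge 0$ is an integer, $x_i^*\in X^*$, $y_i^*\in Y^*$ and $\beta_i\in\mathbb{R}$. If $A_2(Y)$ is closed in $Z$, then $\operatorname{dom}F=\{x\in X\mid F(x)\neq\emptyset\}$ is a generalized polyhedral convex set. -/

import Mathlib

universe u v w

/-- A (real) Fréchet space: a locally convex Hausdorff topological vector space whose topology is
induced by a complete (translation-)invariant metric. -/
class IsFrechetSpace (E : Type u) [AddCommGroup E] [Module ℝ E] [t : TopologicalSpace E] : Prop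
    extends IsTopologicalAddGroup E, ContinuousSMul ℝ E, LocallyConvexSpace ℝ E, T2Space E where
  exists_complete_invariant_metric : ∃ d : MetricSpace E,
    d.toUniformSpace.toTopologicalSpace = t ∧
    (∀ x y a : E, d.dist (x + a) (y + a) = d.dist x y) ∧
    @CompleteSpace E d.toUniformSpace

/-- `T` is closed under finite-codimensional subspaces: `T(X₀)` is closed for every closed linear
subspace `X₀` such that the quotient `X / X₀` is finite-dimensional. -/
def ClosedUnderFiniteCodim {X : Type u} {Y : Type v}
    [AddCommGroup X] [Module ℝ X] [TopologicalSpace X]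
    [AddCommGroup Y] [Module ℝ Y] [TopologicalSpace Y] (T : X →L[ℝ] Y) : Prop :=
  ∀ X₀ : Submodule ℝ X, IsClosed (X₀ : Set X) → FiniteDimensional ℝ (X ⧸ X₀) →
    IsClosed (T '' (X₀ : Set X))

/-- A generalized polyhedral convex set: the intersection of a closed affine subspace with finitely
many (possibly zero) sets `{x | ⟨x*ᵢ, x⟩ ≤ αᵢ}`, where the `x*ᵢ` are continuous linear
functionals. -/
def IsGeneralizedPolyhedralConvex {X : Type u}
    [AddCommGroup X] [Module ℝ X] [TopologicalSpace X] (D : Set X) : Prop :=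
  ∃ (L : AffineSubspace ℝ X) (m : ℕ) (xs : Fin m → (X →L[ℝ] ℝ)) (α : Fin m → ℝ),
    IsClosed (L : Set X) ∧ D = {x : X | x ∈ L ∧ ∀ i, xs i x ≤ α i}

/-- The domain of a multifunction `F : X ⇉ Y`. -/
def multifunctionDom {X : Type u} {Y : Type v} (F : X → Set Y) : Set X :=
  {x : X | (F x).Nonempty}

/-- The graph of a multifunction `F : X ⇉ Y`. -/
def multifunctionGraph {X : Type u} {Y : Type v} (F : X → Set Y) : Set (X × Y) :=
  {p : X × Y | p.1 ∈ multifunctionDom F ∧ p.2 ∈ F p.1}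

/-! (1) A closed range is Baire, so `T` is open onto it, and `T(X₀)` is closed as soon as its
preimage `X₀ + ker T` is. That subspace contains the closed, finite-codimensional `X₀`.

(2) Let `P`, `Q` collect the `xs`, `ys` into maps to `ℝ^m`, and put `W = Q(ker A₂)`. If `A₂ y₀ = z -
A₁ x`, then `x` is in the domain iff `P x + Q y₀ - β` lies in `W` plus the nonpositive orthant.
Fourier–Motzkin elimination describes this cone by finitely many functionals `f`, all zero on `W`.
Then `f ∘ Q` vanishes on `ker A₂`, so by (1) and Hahn–Banach it equals `φ ∘ A₂` with `φ` continuous.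
Hence `f (Q y₀) = φ (z - A₁ x)`, and `y₀` drops out. -/

section Auxiliary

open Filter Topology Set

/-! ### Open mapping theorem -/

section OpenMapping

variable {X : Type u} {Y : Type v} [AddCommGroup X] [Module ℝ X]
  [AddCommGroup Y] [Module ℝ Y] [TopologicalSpace Y] [IsTopologicalAddGroup Y] [ContinuousSMul ℝ Y]

/-- A surjective continuous linear map onto a Baire space is almost open at zero. -/
theorem ContinuousLinearMap.closure_image_mem_nhds_zero [TopologicalSpace X]
    [IsTopologicalAddGroup X] [ContinuousSMul ℝ X] [BaireSpace Y] (T : X →L[ℝ] Y)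
    (hT : Function.Surjective T) {U : Set X} (hU : U ∈ 𝓝 (0 : X)) :
    closure (T '' U) ∈ 𝓝 (0 : Y) := by
  obtain ⟨V, hV, hVU⟩ : ∃ V ∈ 𝓝 (0 : X), ∀ x ∈ V, ∀ y ∈ V, x - y ∈ U := by
    have h : Tendsto (fun p : X × X => p.1 - p.2) (𝓝 (0 : X) ×ˢ 𝓝 (0 : X)) (𝓝 0) := by
      rw [← nhds_prod_eq]
      exact Continuous.tendsto' (by fun_prop) _ _ (by simp)
    obtain ⟨V, hV, h'⟩ := (((𝓝 (0 : X)).basis_sets.prod_self).mem_iff).1 (h hU)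
    exact ⟨V, hV, fun x hx y hy => h' (mk_mem_prod hx hy)⟩
  -- Baire category: the closed sets `(n + 1) • closure (T '' V)` cover `Y`.
  obtain ⟨n, hn⟩ : ∃ n : ℕ,
      (interior ((fun y : Y => ((n : ℝ) + 1)⁻¹ • y) ⁻¹' closure (T '' V))).Nonempty := by
    refine nonempty_interior_of_iUnion_of_closed
      (fun n => isClosed_closure.preimage (continuous_const_smul _)) ?_
    refine eq_univ_of_forall fun y => ?_
    obtain ⟨x, rfl⟩ := hT y
    have h : Tendsto (fun n : ℕ => ((n : ℝ) + 1)⁻¹ • x) atTop (𝓝 0) := by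
      simpa [one_div] using (tendsto_one_div_add_atTop_nhds_zero_nat (𝕜 := ℝ)).smul_const x
    obtain ⟨n, hn⟩ := (h.eventually_mem hV).exists
    exact mem_iUnion.2 ⟨n, subset_closure ⟨_, hn, map_smul _ _ _⟩⟩
  obtain ⟨y, hy⟩ := hn
  rw [mem_interior_iff_mem_nhds] at hy
  have key : Tendsto (fun z : Y => y + ((n : ℝ) + 1) • z) (𝓝 0) (𝓝 y) :=
    Continuous.tendsto' (by fun_prop) _ _ (by simp)
  filter_upwards [key hy] with z hz
  have hn1 : ((n : ℝ) + 1) ≠ 0 := by positivity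
  have h1 : ((n : ℝ) + 1)⁻¹ • y + z ∈ closure (T '' V) := by
    simpa [smul_smul, inv_mul_cancel₀ hn1] using hz
  have h2 : ((n : ℝ) + 1)⁻¹ • y ∈ closure (T '' V) := (mem_of_mem_nhds hy :)
  have h3 := map_mem_closure₂ (f := fun a b : Y => a - b) (u := T '' U) (by fun_prop) h1 h2 (by
    rintro _ ⟨a, ha, rfl⟩ _ ⟨b, hb, rfl⟩
    exact ⟨a - b, hVU a ha b hb, map_sub _ _ _⟩)
  simpa using h3

/-- The open mapping theorem for linear maps from a completely and invariantly metrized real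
topological vector space onto a Hausdorff Baire one. -/
theorem ContinuousLinearMap.isOpenMap_of_invariant_dist [MetricSpace X] [CompleteSpace X]
    [IsTopologicalAddGroup X] [ContinuousSMul ℝ X] [BaireSpace Y] [T2Space Y]
    (hd : ∀ x y a : X, dist (x + a) (y + a) = dist x y) (T : X →L[ℝ] Y)
    (hT : Function.Surjective T) : IsOpenMap T := by
  rw [IsTopologicalAddGroup.isOpenMap_iff_nhds_zero, le_map_iff]
  intro U hU
  obtain ⟨ε, hε, hεU⟩ := Metric.mem_nhds_iff.1 hU
  -- Corrections of size `C / 2 / 2 ^ n` add up to `C`, which is strictly below `ε`.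
  set C : ℝ := ε / 2 with hC
  have hC0 : 0 < C := by positivity
  let K : ℕ → Set Y := fun n => closure (T '' Metric.ball (0 : X) (C / 2 / 2 ^ n))
  have hK : ∀ n, K n ∈ 𝓝 (0 : Y) := fun n =>
    T.closure_image_mem_nhds_zero hT (Metric.ball_mem_nhds _ (by positivity))
  refine mem_of_superset (hK 0) fun y hy => ?_
  -- Successive approximation: a small correction of `x` moves the residual from `K n` into `K (n +
  -- 1)`.
  have step : ∀ n (x : {x : X // y - T x ∈ K n}), ∃ x' : {x : X // y - T x ∈ K (n + 1)},
      dist (x : X) x' ≤ C / 2 / 2 ^ n := by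
    rintro n ⟨x, hx⟩
    have h : Tendsto (fun z : Y => y - T x - z) (𝓝 (y - T x)) (𝓝 0) :=
      Continuous.tendsto' (by fun_prop) _ _ (by simp)
    obtain ⟨_, hz, a, ha, rfl⟩ := mem_closure_iff_nhds.1 hx _ (h (hK (n + 1)))
    refine ⟨⟨x + a, ?_⟩, ?_⟩
    · simpa [sub_sub] using hz
    · have := hd 0 a x
      rw [zero_add, add_comm a x] at this
      rw [this, dist_comm]
      exact (Metric.mem_ball.1 ha).le
  choose g hg using step
  let s : ∀ n, {x : X // y - T x ∈ K n} :=
    fun n => Nat.rec ⟨0, by simpa using hy⟩ (fun n x => g n x) n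
  have hs : ∀ n, dist (s n).1 (s (n + 1)).1 ≤ C / 2 / 2 ^ n := fun n => hg n (s n)
  obtain ⟨a, ha⟩ := cauchySeq_tendsto_of_complete (cauchySeq_of_le_geometric_two hs)
  have hdist : dist (0 : X) a ≤ C := dist_le_of_le_geometric_two_of_tendsto₀ hs ha
  refine ⟨a, hεU ?_, ?_⟩
  · rw [Metric.mem_ball, dist_comm]
    linarith
  have hres : Tendsto (fun n => y - T (s n).1) atTop (𝓝 0) := by
    refine (closed_nhds_basis (0 : Y)).tendsto_right_iff.2 fun V ⟨hV, hVc⟩ => ?_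
    have h0 : T ⁻¹' V ∈ 𝓝 (0 : X) := T.continuous.continuousAt (by simpa using hV)
    obtain ⟨δ, hδ, hδV⟩ := Metric.mem_nhds_iff.1 h0
    have hr : Tendsto (fun n : ℕ => C / 2 / 2 ^ n) atTop (𝓝 0) := by
      simpa [div_eq_mul_inv] using
        (tendsto_pow_atTop_nhds_zero_of_lt_one (r := (2 : ℝ)⁻¹) (by norm_num)
          (by norm_num)).const_mul (C / 2)
    filter_upwards [hr.eventually_lt_const hδ] with n hn
    refine closure_minimal ?_ hVc (s n).2
    rw [image_subset_iff]
    exact (Metric.ball_subset_ball hn.le).trans hδV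
  have hlim : Tendsto (fun n => y - T (s n).1) atTop (𝓝 (y - T a)) :=
    tendsto_const_nhds.sub ((T.continuous.tendsto a).comp ha)
  exact (sub_eq_zero.1 (tendsto_nhds_unique hlim hres)).symm

end OpenMapping

theorem ClosedUnderFiniteCodim.isClosed_range {X : Type u} {Y : Type v}
    [AddCommGroup X] [Module ℝ X] [TopologicalSpace X]
    [AddCommGroup Y] [Module ℝ Y] [TopologicalSpace Y] {T : X →L[ℝ] Y}
    (h : ClosedUnderFiniteCodim T) : IsClosed (range T) := by
  have := h ⊤ isClosed_univ inferInstance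
  rwa [Submodule.top_coe, image_univ] at this

/-! ### Images of finite-codimensional subspaces -/

section Frechet

theorem IsFrechetSpace.isCompletelyMetrizableSpace (E : Type u) [AddCommGroup E] [Module ℝ E]
    [t : TopologicalSpace E] [h : IsFrechetSpace E] :
    TopologicalSpace.IsCompletelyMetrizableSpace E := by
  obtain ⟨d, hd, -, hc⟩ := h.exists_complete_invariant_metric
  exact ⟨d, hd, hc⟩

variable {X : Type u} {Y : Type v} [AddCommGroup X] [Module ℝ X] [t : TopologicalSpace X]
  [hX : IsFrechetSpace X] [AddCommGroup Y] [Module ℝ Y] [TopologicalSpace Y]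

theorem IsFrechetSpace.isOpenMap_of_surjective [IsTopologicalAddGroup Y] [ContinuousSMul ℝ Y]
    [T2Space Y] [BaireSpace Y] (T : X →L[ℝ] Y) (hT : Function.Surjective T) : IsOpenMap T := by
  obtain ⟨d, rfl, hd, hc⟩ := hX.exists_complete_invariant_metric
  exact T.isOpenMap_of_invariant_dist hd hT

/-- A continuous linear map with closed range between Fréchet spaces maps closed subspaces of finite
codimension to closed subspaces. -/
theorem IsFrechetSpace.closedUnderFiniteCodim_of_isClosed_range [hY : IsFrechetSpace Y]
    (T : X →L[ℝ] Y) (hT : IsClosed (range T)) : ClosedUnderFiniteCodim T := by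
  intro X₀ hX₀ _
  have := IsFrechetSpace.isCompletelyMetrizableSpace Y
  have hemb : IsClosedEmbedding (Subtype.val : T.range → Y) :=
    IsClosed.isClosedEmbedding_subtypeVal (by exact hT)
  have : TopologicalSpace.IsCompletelyMetrizableSpace T.range := hemb.IsCompletelyMetrizableSpace
  have hsurj : Function.Surjective T.rangeRestrict := fun ⟨_, x, hx⟩ => ⟨x, Subtype.ext hx⟩
  have hopen : IsOpenMap T.rangeRestrict := IsFrechetSpace.isOpenMap_of_surjective _ hsurj
  have himg : IsClosed (T.rangeRestrict '' (X₀ : Set X)) := by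
    rw [← (hopen.isQuotientMap T.rangeRestrict.continuous hsurj).isClosed_preimage]
    have h := Submodule.isClosed_mono_of_finiteDimensional_quotient hX₀
      (le_sup_left : X₀ ≤ X₀ ⊔ LinearMap.ker (T.rangeRestrict : X →ₗ[ℝ] T.range))
    rwa [← Submodule.comap_map_eq] at h
  have := hemb.isClosedMap _ himg
  rwa [image_image] at this

theorem IsFrechetSpace.closedUnderFiniteCodim_iff [hY : IsFrechetSpace Y]
    (T : X →L[ℝ] Y) : ClosedUnderFiniteCodim T ↔ IsClosed (range T) :=
  ⟨fun h => h.isClosed_range, IsFrechetSpace.closedUnderFiniteCodim_of_isClosed_range T⟩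

end Frechet

/-! ### Fourier–Motzkin elimination -/

section Elimination

theorem Set.Finite.exists_between_of_forall_le {A B : Set ℝ} (hA : A.Finite) (hB : B.Finite)
    (h : ∀ a ∈ A, ∀ b ∈ B, a ≤ b) : ∃ t, (∀ a ∈ A, a ≤ t) ∧ ∀ b ∈ B, t ≤ b := by
  rcases A.eq_empty_or_nonempty with rfl | hA0
  · obtain ⟨t, ht⟩ := hB.bddBelow
    exact ⟨t, by simp, fun b hb => ht hb⟩
  · exact ⟨sSup A, fun a ha => le_csSup hA.bddAbove ha,
      fun b hb => csSup_le hA0 fun a ha => h a ha b hb⟩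

/-- A finite system of affine inequalities in one real variable is solvable as soon as the
inequalities obtained by eliminating the variable from pairs of them hold. -/
theorem exists_forall_add_mul_nonpos {ι : Type*} (s : Set ι) (hs : s.Finite) (a b : ι → ℝ)
    (h0 : ∀ i ∈ s, b i = 0 → a i ≤ 0)
    (h1 : ∀ i ∈ s, ∀ j ∈ s, 0 < b i → b j < 0 → b i * a j - b j * a i ≤ 0) :
    ∃ t : ℝ, ∀ i ∈ s, a i + t * b i ≤ 0 := by
  have hfin : ∀ P : ι → Prop, ((fun i => -a i / b i) '' {i ∈ s | P i}).Finite := fun P =>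
    (hs.subset (sep_subset _ _)).image _
  obtain ⟨t, hl, hu⟩ : ∃ t, (∀ x ∈ (fun i => -a i / b i) '' {i ∈ s | b i < 0}, x ≤ t) ∧
      ∀ x ∈ (fun i => -a i / b i) '' {i ∈ s | 0 < b i}, t ≤ x := by
    refine (hfin _).exists_between_of_forall_le (hfin _) ?_
    rintro _ ⟨j, ⟨hj, hbj⟩, rfl⟩ _ ⟨i, ⟨hi, hbi⟩, rfl⟩
    have := h1 i hi j hj hbi hbj
    change -a j / b j ≤ -a i / b i
    rw [div_le_iff_of_neg hbj, div_mul_eq_mul_div, div_le_iff₀ hbi]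
    linarith
  refine ⟨t, fun i hi => ?_⟩
  rcases lt_trichotomy (b i) 0 with hb | hb | hb
  · have := hl _ ⟨i, ⟨hi, hb⟩, rfl⟩
    rw [div_le_iff_of_neg hb] at this
    linarith
  · simpa [hb] using h0 i hi hb
  · have := hu _ ⟨i, ⟨hi, hb⟩, rfl⟩
    rw [le_div_iff₀ hb] at this
    linarith

variable {V : Type*} [AddCommGroup V] [Module ℝ V]

/-- Functionals killing `w` are kept; each pair of opposite signs at `w` has a positive combination
that kills `w`. -/
theorem exists_finite_dual_forall_span_singleton (w : V) {s : Set (Module.Dual ℝ V)}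
    (hs : s.Finite) : ∃ s' : Set (Module.Dual ℝ V), s'.Finite ∧
      ∀ v, (∃ t : ℝ, ∀ f ∈ s, f (v + t • w) ≤ 0) ↔ ∀ f ∈ s', f v ≤ 0 := by
  refine ⟨{f ∈ s | f w = 0} ∪ (fun p : Module.Dual ℝ V × Module.Dual ℝ V =>
      p.1 w • p.2 - p.2 w • p.1) '' {p ∈ s ×ˢ s | 0 < p.1 w ∧ p.2 w < 0},
    (hs.subset (sep_subset _ _)).union (((hs.prod hs).subset (sep_subset _ _)).image _),
    fun v => ⟨?_, fun h => ?_⟩⟩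
  · rintro ⟨t, ht⟩ f (⟨hf, hf0⟩ | ⟨⟨g, k⟩, ⟨⟨hg, hk⟩, hgw, hkw⟩, rfl⟩)
    · simpa [hf0] using ht f hf
    · have h1 := ht g hg
      have h2 := ht k hk
      simp only [map_add, map_smul, smul_eq_mul, LinearMap.sub_apply, LinearMap.smul_apply]
        at h1 h2 hgw hkw ⊢
      nlinarith
  · obtain ⟨t, ht⟩ := exists_forall_add_mul_nonpos s hs (fun f => f v) (fun f => f w)
      (fun f hf hf0 => h f (Or.inl ⟨hf, hf0⟩))
      (fun f hf g hg hfw hgw => h _ (Or.inr ⟨(f, g), ⟨⟨hf, hg⟩, hfw, hgw⟩, rfl⟩))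
    exact ⟨t, fun f hf => by simpa using ht f hf⟩

/-- Fourier–Motzkin elimination: the sum of a finitely generated subspace and a polyhedral cone
is a polyhedral cone. -/
theorem Submodule.FG.exists_finite_dual_forall {W : Submodule ℝ V} (hW : W.FG)
    {s : Set (Module.Dual ℝ V)} (hs : s.Finite) : ∃ s' : Set (Module.Dual ℝ V), s'.Finite ∧
      ∀ v, (∃ w ∈ W, ∀ f ∈ s, f (v + w) ≤ 0) ↔ ∀ f ∈ s', f v ≤ 0 := by
  induction W, hW using Submodule.fg_induction generalizing s with
  | singleton w =>
    simpa [Submodule.mem_span_singleton] using exists_finite_dual_forall_span_singleton w hs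
  | sup W₁ W₂ _ _ ih₁ ih₂ =>
    obtain ⟨s₁, hs₁, h₁⟩ := ih₁ hs
    obtain ⟨s₂, hs₂, h₂⟩ := ih₂ hs₁
    refine ⟨s₂, hs₂, fun v => ?_⟩
    simp_rw [← h₂, ← h₁, Submodule.mem_sup]
    constructor
    · rintro ⟨_, ⟨w₁, hw₁, w₂, hw₂, rfl⟩, h⟩
      exact ⟨w₂, hw₂, w₁, hw₁, by simpa [add_assoc, add_comm w₂ w₁] using h⟩
    · rintro ⟨w₂, hw₂, w₁, hw₁, h⟩
      exact ⟨_, ⟨w₁, hw₁, w₂, hw₂, rfl⟩, by simpa [add_assoc, add_comm w₂ w₁] using h⟩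

end Elimination

/-! ### Factoring functionals through `A` -/

section Factor

/-- A linear functional that is bounded above on a subspace vanishes there. -/
theorem LinearMap.eq_zero_of_forall_lt {E : Type*} [AddCommGroup E] [Module ℝ E]
    (f : E →ₗ[ℝ] ℝ) (N : Submodule ℝ E) (c : ℝ)
    (h : ∀ x ∈ N, f x < c) {x : E} (hx : x ∈ N) : f x = 0 := by
  by_contra hne
  have := h ((c / f x) • x) (N.smul_mem _ hx)
  rw [map_smul, smul_eq_mul, div_mul_cancel₀ _ hne] at this
  exact lt_irrefl _ this

variable {Y : Type v} {Z : Type w} [AddCommGroup Y] [Module ℝ Y] [TopologicalSpace Y]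
  [AddCommGroup Z] [Module ℝ Z] [TopologicalSpace Z] [IsTopologicalAddGroup Z]
  [ContinuousSMul ℝ Z] [LocallyConvexSpace ℝ Z]

/-- A functional vanishing on the kernel of `A` factors through a continuous functional on the
target of `A`, provided the image of its kernel is closed. -/
theorem ContinuousLinearMap.exists_comp_eq_of_isClosed_image_ker (A : Y →L[ℝ] Z) (g : Y →ₗ[ℝ] ℝ)
    (hg : ∀ y, A y = 0 → g y = 0) (hcl : IsClosed (A '' (LinearMap.ker g : Set Y))) :
    ∃ φ : Z →L[ℝ] ℝ, ∀ y, φ (A y) = g y := by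
  by_cases h0 : ∀ y, g y = 0
  · exact ⟨0, fun y => by simp [h0]⟩
  push Not at h0
  obtain ⟨y₀, hy₀⟩ := h0
  let N : Submodule ℝ Z := (LinearMap.ker g).map (A : Y →ₗ[ℝ] Z)
  have hN : IsClosed (N : Set Z) := hcl
  have hy₀N : A y₀ ∉ N := by
    rintro ⟨k, hk, hkA⟩
    have h1 := hg (y₀ - k) (by rw [map_sub, sub_eq_zero]; exact hkA.symm)
    rw [map_sub, LinearMap.mem_ker.1 hk, sub_zero] at h1
    exact hy₀ h1
  obtain ⟨f, c, hfc, hcf⟩ := geometric_hahn_banach_closed_point N.convex hN hy₀N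
  have hfN : ∀ x ∈ N, f x = 0 := fun x hx =>
    LinearMap.eq_zero_of_forall_lt (f : Z →ₗ[ℝ] ℝ) N c hfc hx
  have hf0 : f (A y₀) ≠ 0 := by
    have := hfc 0 N.zero_mem
    rw [map_zero] at this
    exact (this.trans hcf).ne'
  -- `f ∘ A` vanishes on `ker g`, hence is a multiple of `g`; the scalar is fixed by matching at
  -- `y₀`.
  refine ⟨(g y₀ / f (A y₀)) • f, fun y => ?_⟩
  have hk : f (A (y - (g y / g y₀) • y₀)) = 0 := hfN _ ⟨_, by
    simp [LinearMap.mem_ker, hy₀], rfl⟩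
  simp only [map_sub, map_smul, smul_eq_mul, sub_eq_zero] at hk
  simp only [_root_.smul_apply, smul_eq_mul, hk]
  field_simp

end Factor

/-! ### Polyhedrality of the domain -/

section Domain

variable {X : Type u} {Y : Type v} {Z : Type w} [AddCommGroup X] [Module ℝ X] [TopologicalSpace X]
  [AddCommGroup Y] [Module ℝ Y] [TopologicalSpace Y]
  [AddCommGroup Z] [Module ℝ Z] [TopologicalSpace Z]

theorem mem_multifunctionDom_iff {α : Type u} {β : Type v} {F : α → Set β} {S : Set (α × β)}
    (h : multifunctionGraph F = S) (x : α) : x ∈ multifunctionDom F ↔ ∃ y, (x, y) ∈ S := by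
  subst h
  exact ⟨fun ⟨y, hy⟩ => ⟨y, ⟨y, hy⟩, hy⟩, fun ⟨_, h, _⟩ => h⟩

/-- The projection to `X` of a generalized polyhedral convex subset of `X × Y` is generalized
polyhedral convex if the map `A₂` maps closed subspaces of finite codimension to closed ones. -/
theorem ClosedUnderFiniteCodim.isGeneralizedPolyhedralConvex_proj
    [IsTopologicalAddGroup Z] [ContinuousSMul ℝ Z] [LocallyConvexSpace ℝ Z]
    (A₁ : X →L[ℝ] Z) {A₂ : Y →L[ℝ] Z} (hA₂ : ClosedUnderFiniteCodim A₂) (z : Z)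
    {m : ℕ} (xs : Fin m → (X →L[ℝ] ℝ)) (ys : Fin m → (Y →L[ℝ] ℝ)) (β : Fin m → ℝ) :
    IsGeneralizedPolyhedralConvex
      {x : X | ∃ y, A₁ x + A₂ y = z ∧ ∀ i, xs i x + ys i y ≤ β i} := by
  let P : X →L[ℝ] (Fin m → ℝ) := ContinuousLinearMap.pi xs
  let Q : Y →L[ℝ] (Fin m → ℝ) := ContinuousLinearMap.pi ys
  let N : Submodule ℝ Y := LinearMap.ker (A₂ : Y →ₗ[ℝ] Z)
  let W : Submodule ℝ (Fin m → ℝ) := N.map (Q : Y →ₗ[ℝ] (Fin m → ℝ))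
  have hW : W.FG := IsNoetherian.noetherian W
  obtain ⟨s, hs, hsW⟩ := hW.exists_finite_dual_forall
    (finite_range fun i : Fin m => (LinearMap.proj i : (Fin m → ℝ) →ₗ[ℝ] ℝ))
  simp only [forall_mem_range, LinearMap.proj_apply, Pi.add_apply] at hsW
  -- The cone contains the subspace `W`, so `f ≤ 0 < 1` on `W`.
  have hs0 : ∀ f ∈ s, ∀ w ∈ W, f w = 0 := fun f hf w hw =>
    LinearMap.eq_zero_of_forall_lt f W 1 (fun x hx => ((hsW x).1
      ⟨-x, W.neg_mem hx, fun i => by simp⟩ f hf).trans_lt one_pos) hw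
  have hφ : ∀ f ∈ s, ∃ φ : Z →L[ℝ] ℝ, ∀ y, φ (A₂ y) = f (Q y) := fun f hf => by
    let g : Y →L[ℝ] ℝ := (LinearMap.toContinuousLinearMap f).comp Q
    have : FiniteDimensional ℝ (Y ⧸ LinearMap.ker (g : Y →ₗ[ℝ] ℝ)) :=
      (LinearMap.quotKerEquivRange (g : Y →ₗ[ℝ] ℝ)).symm.finiteDimensional
    exact A₂.exists_comp_eq_of_isClosed_image_ker (g : Y →ₗ[ℝ] ℝ)
      (fun y hy => hs0 f hf _ ⟨y, hy, rfl⟩) (hA₂ _ g.isClosed_ker this)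
  obtain ⟨k, e, rfl⟩ := hs.fin_embedding
  rw [forall_mem_range] at hφ
  choose φ hφ using hφ
  let L : AffineSubspace ℝ X := (LinearMap.range (A₂ : Y →ₗ[ℝ] Z)).toAffineSubspace.comap
    (AffineMap.const ℝ X z - (A₁ : X →ₗ[ℝ] Z).toAffineMap)
  refine ⟨L, k, fun i => (LinearMap.toContinuousLinearMap (e i)).comp P - (φ i).comp A₁,
    fun i => e i β - φ i z, hA₂.isClosed_range.preimage (continuous_const.sub A₁.continuous), ?_⟩
  ext x
  -- The solutions of the equation form `y₀ + ker A₂`, so `Q y` ranges over `Q y₀ + W`.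
  have main : ∀ y₀, A₂ y₀ = z - A₁ x →
      ((∃ y, A₁ x + A₂ y = z ∧ ∀ i, xs i x + ys i y ≤ β i) ↔
        ∀ i, e i (P x + Q y₀ - β) ≤ 0) := fun y₀ hy₀ => by
    rw [← forall_mem_range (f := e) (p := fun f => f (P x + Q y₀ - β) ≤ 0), ← hsW]
    constructor
    · rintro ⟨y, hy, hi⟩
      refine ⟨Q (y - y₀), ⟨y - y₀, ?_, rfl⟩, fun i => ?_⟩
      · change A₂ (y - y₀) = 0
        rw [map_sub, hy₀, ← hy]
        abel
      · have h := hi i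
        change xs i x + ys i y₀ - β i + ys i (y - y₀) ≤ 0
        rw [map_sub]
        linarith
    · rintro ⟨_, ⟨n, hn, rfl⟩, h⟩
      have hn' : A₂ n = 0 := hn
      refine ⟨y₀ + n, by rw [map_add, hy₀, hn']; abel, fun i => ?_⟩
      have h' : xs i x + ys i y₀ - β i + ys i n ≤ 0 := h i
      rw [map_add]
      linarith
  have value : ∀ y₀, A₂ y₀ = z - A₁ x → ∀ i,
      (e i (P x + Q y₀ - β) ≤ 0 ↔ e i (P x) - φ i (A₁ x) ≤ e i β - φ i z) := fun y₀ hy₀ i => by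
    rw [map_sub, map_add, ← hφ, hy₀, map_sub]
    constructor <;> intro h <;> linarith
  constructor
  · rintro ⟨y, hy⟩
    have hy₀ : A₂ y = z - A₁ x := by rw [← hy.1]; abel
    exact ⟨⟨y, hy₀⟩, fun i => (value y hy₀ i).1 ((main y hy₀).1 ⟨y, hy⟩ i)⟩
  · rintro ⟨⟨y₀, hy₀⟩, h⟩
    exact (main y₀ hy₀).2 fun i => (value y₀ hy₀ i).2 (h i)

end Domain

end Auxiliary

theorem theorem3p11 :
    (∀ (X : Type u) (Y : Type v)
      [AddCommGroup X] [Module ℝ X] [TopologicalSpace X] [IsFrechetSpace X]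
      [AddCommGroup Y] [Module ℝ Y] [TopologicalSpace Y] [IsFrechetSpace Y]
      (T : X →L[ℝ] Y),
      ClosedUnderFiniteCodim T ↔ IsClosed (Set.range T)) ∧
    (∀ (X : Type u) (Y : Type v) (Z : Type w)
      [AddCommGroup X] [Module ℝ X] [TopologicalSpace X] [IsTopologicalAddGroup X]
      [ContinuousSMul ℝ X] [LocallyConvexSpace ℝ X] [T2Space X]
      [AddCommGroup Y] [Module ℝ Y] [TopologicalSpace Y] [IsFrechetSpace Y]
      [AddCommGroup Z] [Module ℝ Z] [TopologicalSpace Z] [IsFrechetSpace Z]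
      (F : X → Set Y) (A₁ : X →L[ℝ] Z) (A₂ : Y →L[ℝ] Z) (z : Z)
      (m : ℕ) (xs : Fin m → (X →L[ℝ] ℝ)) (ys : Fin m → (Y →L[ℝ] ℝ)) (β : Fin m → ℝ),
      multifunctionGraph F =
        {p : X × Y | A₁ p.1 + A₂ p.2 = z ∧ ∀ i, xs i p.1 + ys i p.2 ≤ β i} →
      IsClosed (Set.range A₂) →
      IsGeneralizedPolyhedralConvex (multifunctionDom F)) := by
  refine ⟨fun X Y _ _ _ _ _ _ _ _ T => IsFrechetSpace.closedUnderFiniteCodim_iff T, ?_⟩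
  intro X Y Z _ _ _ _ _ _ _ _ _ _ _ _ _ _ _ F A₁ A₂ z m xs ys β hF hA₂
  have h := (IsFrechetSpace.closedUnderFiniteCodim_of_isClosed_range A₂
    hA₂).isGeneralizedPolyhedralConvex_proj A₁ z xs ys β
  rwa [show multifunctionDom F = _ from Set.ext (mem_multifunctionDom_iff hF)]
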